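/- Let $q$ be a power of $2$. There is no spread of type $\mathcal{C}$ with ambient space $(\mathbb{F}_{q^{8}},+)$ and kernel $\mathbb{F}_q$. Here a spread $\mathcal{S}$ of a $2n$-dimensional $\mathbb{F}_q$-vector space $V$ is a collection of $n$-dimensional $\mathbb{F}_q$-subspaces (the components) such that every nonzero vector lies in exactly one of them. Its kernel is the ring of additive endomorphisms of $V$ that leave every component invariant; the kernel is $\mathbb{F}_q$ if it consists exactly of the scalar maps $v\mapsto cv$ with $c\in\mathbb{F}_q$. $\mathrm{Aut}(\mathcal{S})$ is the group of all $g\in\Gamma L(V)$ with $\{g(W):W\in\mathcal{S}\}=\mathcal{S}$, and two spreads $\mathcal{S},\mathcal{S}'$ of $V$ are isomorphic if $\mathcal{S}'=\{g(W):W\in\mathcal{S}\}$ for some $g\in\Gamma L(V)$. Let $V=\mathbb{F}_{q^{2n}}$, regarded as a $2n$-dimensional vector space over $\mathbb{F}_q$ (so $n=4$ in the assertion above), and for $a\in\mathbb{F}_{q^{2n}}^*$ put $\Theta(a):x\mapsto ax$. A spread $\mathcal{S}$ with ambient space $(\mathbb{F}_{q^{2n}},+)$ is of type $\mathcal{C}$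 if $\mathrm{Aut}(\mathcal{S})$ is transitive on the components and some spread $\mathcal{S}'$ isomorphic to $\mathcal{S}$ satisfies $$\mathrm{Aut}(\mathcal{S}')\cap\{\Theta(a):a\in\mathbb{F}_{q^{2n}}^*\}=\langle\Theta(\beta)\rangle$$ for some element $\beta\in\mathbb{F}_{q^{2n}}^*$ of order $(q^n+1)(q-1)$. -/

import Mathlib

/-- A spread of the `2n`-dimensional `K`-space `V`: a collection of `n`-dimensional subspaces
(the components) such that every nonzero vector lies in exactly one of them. -/
def IsSpread {K V : Type*} [Field K] [AddCommGroup V] [Module K V]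
    (n : ℕ) (S : Set (Submodule K V)) : Prop :=
  Module.finrank K V = 2 * n ∧ (∀ W ∈ S, Module.finrank K W = n) ∧
    ∀ v : V, v ≠ 0 → ∃! W : Submodule K V, W ∈ S ∧ v ∈ W

/-- The group `ΓL(V)` of bijections of the `K`-space `V` that are additive and semilinear with
respect to some automorphism `σ` of `K`. -/
def semilinearGroup (K V : Type*) [Field K] [AddCommGroup V] [Module K V] :
    Subgroup (Equiv.Perm V) where
  carrier := {g | (∀ u v : V, g (u + v) = g u + g v) ∧
    ∃ σ : K ≃+* K, ∀ (c : K) (v : V), g (c • v) = σ c • g v}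
  one_mem' := ⟨fun _ _ => rfl, RingEquiv.refl K, fun _ _ => rfl⟩
  mul_mem' := by
    rintro g h ⟨hg, σ, hσ⟩ ⟨hh, τ, hτ⟩
    refine ⟨fun u v => ?_, τ.trans σ, fun c v => ?_⟩
    · simp only [Equiv.Perm.mul_apply, hh, hg]
    · simp only [Equiv.Perm.mul_apply, hτ, hσ, RingEquiv.trans_apply]
  inv_mem' := by
    rintro g ⟨hg, σ, hσ⟩
    refine ⟨fun u v => g.injective ?_, σ.symm, fun c v => g.injective ?_⟩
    · simp only [hg, Equiv.Perm.coe_inv, Equiv.apply_symm_apply]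
    · simp only [hσ, Equiv.Perm.coe_inv, Equiv.apply_symm_apply, RingEquiv.apply_symm_apply]

/-- `T = {g(W) : W ∈ S}`, as an equality of collections of subsets of `V`. -/
def MapsOnto {K V : Type*} [Field K] [AddCommGroup V] [Module K V]
    (g : Equiv.Perm V) (S T : Set (Submodule K V)) : Prop :=
  (fun W : Submodule K V => g '' (W : Set V)) '' S = (fun W : Submodule K V => (W : Set V)) '' T

/-- Two spreads are isomorphic if an element of `ΓL(V)` maps one onto the other. -/
def SpreadIsomorphic {K V : Type*} [Field K] [AddCommGroup V] [Module K V]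
    (S T : Set (Submodule K V)) : Prop :=
  ∃ g ∈ semilinearGroup K V, MapsOnto g S T

/-- `Aut(S)`: the elements of `ΓL(V)` that map the set of components of `S` onto itself. -/
def spreadAut {K V : Type*} [Field K] [AddCommGroup V] [Module K V]
    (S : Set (Submodule K V)) : Subgroup (Equiv.Perm V) where
  carrier := {g | g ∈ semilinearGroup K V ∧ MapsOnto g S S}
  one_mem' := ⟨one_mem _, by simp [MapsOnto]⟩
  mul_mem' := by
    rintro g h ⟨hg, hgS⟩ ⟨hh, hhS⟩
    refine ⟨mul_mem hg hh, ?_⟩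
    unfold MapsOnto at *
    have e : (fun W : Submodule K V => (g * h : Equiv.Perm V) '' (W : Set V))
        = fun W : Submodule K V => g '' (h '' (W : Set V)) := by
      funext W
      rw [Set.image_image]
      rfl
    rw [e, ← Set.image_image (fun X : Set V => g '' X), hhS, Set.image_image, hgS]
  inv_mem' := by
    rintro g ⟨hg, hgS⟩
    refine ⟨inv_mem hg, ?_⟩
    unfold MapsOnto at *
    rw [← Set.image_image (fun X : Set V => (g⁻¹ : Equiv.Perm V) '' X)
      (fun W : Submodule K V => (W : Set V)), ← hgS, Set.image_image]
    simpa [Set.image_image] using hgS.symm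

/-- The kernel of `S`: the ring of endomorphisms of `(V, +)` that leave each component invariant. -/
def spreadKernel {K V : Type*} [Field K] [AddCommGroup V] [Module K V]
    (S : Set (Submodule K V)) : Subring (AddMonoid.End V) where
  carrier := {f | ∀ W ∈ S, ∀ v ∈ W, f v ∈ W}
  zero_mem' := fun W _ _ _ => W.zero_mem
  one_mem' := fun _ _ _ hv => hv
  add_mem' := fun hf hg W hW v hv => W.add_mem (hf W hW v hv) (hg W hW v hv)
  mul_mem' := fun hf hg W hW v hv => hf W hW _ (hg W hW v hv)
  neg_mem' := fun hf W hW v hv => W.neg_mem (hf W hW v hv)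

/-- The spread `S` has kernel `K`: its kernel consists exactly of the scalar maps `v ↦ c • v`
with `c` in `K`. -/
def HasKernelBaseField {K V : Type*} [Field K] [AddCommGroup V] [Module K V]
    (S : Set (Submodule K V)) : Prop :=
  spreadKernel S = (Module.toAddMonoidEnd K V).range

/-- `Aut(S)` is transitive on the components of `S`, that is, the affine plane of `S` is
flag-transitive. -/
def IsFlagTransitiveSpread {K V : Type*} [Field K] [AddCommGroup V] [Module K V]
    (S : Set (Submodule K V)) : Prop :=
  ∀ W ∈ S, ∀ W' ∈ S, ∃ g ∈ spreadAut S, g '' (W : Set V) = (W' : Set V)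

/-- The Singer group of the field `L`: all maps `Θ(a) : x ↦ a * x` with `a ≠ 0`. For a finite
field it is cyclic, generated by `Θ(γ)` for any primitive element `γ`. -/
def singerGroup (L : Type*) [Field L] : Subgroup (Equiv.Perm L) :=
  (MulAction.toPermHom Lˣ L).range

/-- Type `𝒞` spreads with ambient space `(L, +)`, where `L` is a field extension of degree `2n` of
`K`, a field of `q` elements: flag-transitive spreads which, possibly after passing to an isomorphic
spread `S'`, satisfy `Aut(S') ∩ Singer = ⟨Θ(β)⟩` with `β` of order `(q ^ n + 1) * (q - 1)`. -/
def IsTypeC {K L : Type*} [Field K] [Field L] [Algebra K L]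
    (n : ℕ) (S : Set (Submodule K L)) : Prop :=
  IsSpread n S ∧ IsFlagTransitiveSpread S ∧
    ∃ S' : Set (Submodule K L), SpreadIsomorphic S S' ∧
      ∃ β : Lˣ, orderOf β = (Nat.card K ^ n + 1) * (Nat.card K - 1) ∧
        spreadAut S' ⊓ singerGroup L = Subgroup.zpowers (MulAction.toPermHom Lˣ L β)

/-! Write `σ x = x ^ q ^ 4`, `F` for its fixed field, N(x) = x σ(x), and T = `traceProduct σ`, the
polar form of N. For nonzero x and y, T(x, y) = 0 means x / y ∈ F.

Every element of norm 1 lies in ⟨β⟩, so multiplication by it permutes the components of `S'`. This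
forces N to be injective, hence bijective onto F, on each component W (`eq_of_pow_eq_pow`). For a
K-functional f that is nonzero on F, the quadratic form f ∘ N on W is therefore equidistributed, so
its character sum is zero. In characteristic 2 such a form cannot vanish on the radical of f ∘ T
(`exists_mem_radical`). Since dim W = 4, the Pfaffian of f ∘ T vanishes for all these f.

These Pfaffian relations either give T = 0 on W directly (`traceProduct_eq_zero_of_pairs`), or yield
a nonzero e ∈ W such that W ∩ eF has dimension at least 3 (`exists_three_le_finrank`). In the second
case `eq_fixedField_of_three_le_finrank`, applied to e⁻¹W, gives W = eF.

So every component is an F-line, `S'` consists of all F-lines of L, and the whole Singer group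
preserves it. Then β has order q ^ 8 - 1, which is larger than (q ^ 4 + 1)(q - 1). -/

/-! ### Character sums of quadratic forms in characteristic 2. -/

section CharacterSums

variable {K : Type*} [Field K]

/-- A finite field has a nontrivial complex additive character. -/
lemma exists_addChar_ne_one (K : Type*) [Field K] [Finite K] :
    ∃ χ : AddChar K ℂ, χ ≠ 1 := by
  obtain ⟨χ, hχ⟩ := AddChar.exists_apply_ne_zero.mpr (one_ne_zero (α := K))
  exact ⟨χ, fun h => hχ (by rw [h, AddChar.one_apply])⟩

/-- The sum of a nontrivial character along a nonzero linear functional vanishes. -/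
lemma sum_addChar_comp_linearMap_eq_zero {V : Type*} [AddCommGroup V] [Module K V] [Fintype V]
    {χ : AddChar K ℂ} (hχ : χ ≠ 1) (f : V →ₗ[K] K) (hf : f ≠ 0) :
    ∑ v, χ (f v) = 0 := by
  have hne : χ.compAddMonoidHom f.toAddMonoidHom ≠ 1 := by
    intro h
    apply hχ
    obtain ⟨v, hv⟩ : ∃ v, f v ≠ 0 := by
      by_contra! h0
      exact hf (LinearMap.ext h0)
    ext a
    have := DFunLike.congr_fun h ((a / f v) • v)
    simpa [AddChar.compAddMonoidHom_apply, hv] using this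
  exact AddChar.sum_eq_zero_of_ne_one hne

/-- If a quadratic form in characteristic two has vanishing character sum, then it does not vanish
identically on the radical of its polar form. -/
lemma exists_radical_ne_zero_of_sum_eq_zero [CharP K 2]
    {V : Type*} [AddCommGroup V] [Module K V] [Finite V] [Fintype V]
    {χ : AddChar K ℂ} (hχ : χ ≠ 1) (Q : V → K) (B : V →ₗ[K] V →ₗ[K] K)
    (hQ : ∀ x h, Q (x + h) = Q x + Q h + B h x) (hsum : ∑ v, χ (Q v) = 0) :
    ∃ h, (∀ x, B h x = 0) ∧ Q h ≠ 0 := by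
  classical
  by_contra! H
  have hB0 : ∀ h, B h = 0 ↔ ∀ x, B h x = 0 := fun h =>
    ⟨fun e x => by simp [e], fun e => LinearMap.ext e⟩
  -- Squaring the sum and putting y = x + h cancels Q x twice over, leaving a linear character in x.
  -- Only h in the radical contributes, with Q h = 0 by assumption, so the square is |V| times the
  -- size of the radical.
  have key : (∑ v, χ (Q v)) * ∑ v, χ (Q v) =
      ∑ h : V, if B h = 0 then (Fintype.card V : ℂ) else 0 := by
    rw [Finset.sum_mul_sum]
    calc ∑ x, ∑ y, χ (Q x) * χ (Q y) = ∑ x, ∑ h, χ (Q x) * χ (Q (x + h)) := by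
          refine Finset.sum_congr rfl fun x _ => ?_
          exact (Equiv.sum_comp (Equiv.addLeft x) fun y => χ (Q x) * χ (Q y)).symm
      _ = ∑ h, ∑ x, χ (Q h) * χ (B h x) := by
          rw [Finset.sum_comm]
          refine Finset.sum_congr rfl fun h _ => Finset.sum_congr rfl fun x _ => ?_
          rw [← AddChar.map_add_eq_mul, ← AddChar.map_add_eq_mul, hQ,
            show Q x + (Q x + Q h + B h x) = (Q x + Q x) + (Q h + B h x) by ring,
            CharTwo.add_self_eq_zero, zero_add]
      _ = _ := by
          refine Finset.sum_congr rfl fun h _ => ?_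
          rw [← Finset.mul_sum]
          split_ifs with h0
          · rw [H h ((hB0 h).1 h0)]
            simp [h0]
          · rw [sum_addChar_comp_linearMap_eq_zero hχ _ h0, mul_zero]
  rw [hsum, zero_mul, ← Finset.sum_filter, Finset.sum_const, nsmul_eq_mul] at key
  have h1 : (Finset.univ.filter fun h : V => B h = 0).card ≠ 0 :=
    Finset.card_ne_zero_of_mem (a := 0) (by simp)
  have h2 : Fintype.card V ≠ 0 := Fintype.card_ne_zero
  exact mul_ne_zero (Nat.cast_ne_zero.mpr h1) (Nat.cast_ne_zero.mpr h2) key.symm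

end CharacterSums

/-! ### Subspaces on which the norm to the fixed field is injective. -/

section Involution

variable {K L : Type*} [Field K] [Field L] [Algebra K L]

/-- The trace form `x σ(y) + σ(x) y` of an automorphism `σ`. -/
def traceProduct (σ : L ≃ₐ[K] L) : L →ₗ[K] L →ₗ[K] L :=
  LinearMap.mk₂ K (fun x y => x * σ y + σ x * y)
    (fun x y z => by simp only [map_add]; ring)
    (fun c x y => by simp only [map_smul, smul_mul_assoc, smul_add])
    (fun x y z => by simp only [map_add]; ring)
    (fun c x y => by simp only [map_smul, mul_smul_comm, smul_add])

@[simp]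
lemma traceProduct_apply (σ : L ≃ₐ[K] L) (x y : L) :
    traceProduct σ x y = x * σ y + σ x * y := rfl

lemma traceProduct_comm (σ : L ≃ₐ[K] L) (x y : L) :
    traceProduct σ x y = traceProduct σ y x := by
  simp only [traceProduct_apply]; ring

lemma traceProduct_mul_mul (σ : L ≃ₐ[K] L) (a x y : L) :
    traceProduct σ (a * x) (a * y) = a * σ a * traceProduct σ x y := by
  simp only [traceProduct_apply, map_mul]; ring

lemma traceProduct_mem {σ : L ≃ₐ[K] L} (hσ : ∀ x, σ (σ x) = x) {F : IntermediateField K L}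
    (hF : ∀ x, x ∈ F ↔ σ x = x) (x y : L) : traceProduct σ x y ∈ F := by
  rw [hF]; simp only [traceProduct_apply, map_add, map_mul, hσ]; ring

lemma mul_map_mem {σ : L ≃ₐ[K] L} (hσ : ∀ x, σ (σ x) = x) {F : IntermediateField K L}
    (hF : ∀ x, x ∈ F ↔ σ x = x) (x : L) : x * σ x ∈ F := by
  rw [hF]; simp only [map_mul, hσ]; ring


/-- For a subspace `W` of the same dimension as the fixed field `F` on which the norm `x σ(x)` is
injective, every functional that is nonzero on `F` gives a quadratic form on `W` that does
not vanish on its radical. -/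
lemma exists_mem_radical [Finite K] [CharP K 2] [FiniteDimensional K L] {σ : L ≃ₐ[K] L}
    (hσ : ∀ x, σ (σ x) = x) {F : IntermediateField K L} (hF : ∀ x, x ∈ F ↔ σ x = x)
    {W : Submodule K L} (hW : Module.finrank K W = Module.finrank K F)
    (hinj : ∀ x ∈ W, ∀ y ∈ W, x * σ x = y * σ y → x = y)
    (f : L →ₗ[K] K) (hf : ∃ u ∈ F, f u ≠ 0) :
    ∃ h ∈ W, (∀ x ∈ W, f (traceProduct σ h x) = 0) ∧ f (h * σ h) ≠ 0 := by
  obtain ⟨χ, hχ⟩ := exists_addChar_ne_one K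
  have : Finite L := Module.finite_of_finite K
  have := Fintype.ofFinite W
  have := Fintype.ofFinite F
  let N : W → F := fun w => ⟨w * σ w, mul_map_mem hσ hF _⟩
  have hN : Function.Injective N := fun x y hxy =>
    Subtype.ext (hinj x x.2 y y.2 (congrArg Subtype.val hxy))
  have hcard : Nat.card F ≤ Nat.card W := by
    rw [Module.natCard_eq_pow_finrank (K := K), Module.natCard_eq_pow_finrank (K := K) (V := W), hW]
  have hbij : Function.Bijective N := hN.bijective_of_nat_card_le hcard
  have hsum : ∑ w : W, χ (f (w * σ w)) = 0 := by
    rw [← sum_addChar_comp_linearMap_eq_zero hχ (f ∘ₗ F.toSubmodule.subtype : F →ₗ[K] K) ?_]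
    · exact Function.Bijective.sum_comp hbij fun u : F => χ (f u)
    · obtain ⟨u, hu, hfu⟩ := hf
      exact fun h0 => hfu (DFunLike.congr_fun h0 (⟨u, hu⟩ : F))
  obtain ⟨h, h1, h2⟩ := exists_radical_ne_zero_of_sum_eq_zero hχ (fun w : W => f (w * σ w))
    (((traceProduct σ).compr₂ f).domRestrict₁₂ W W) (fun x h => by
      simp only [LinearMap.domRestrict₁₂_apply, LinearMap.compr₂_apply, ← map_add,
        traceProduct_apply, Submodule.coe_add]
      rw [map_add σ]
      congr 1
      ring) hsum
  exact ⟨h, h.2, fun x hx => h1 ⟨x, hx⟩, h2⟩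

lemma trace_sq {E : Type*} [Field E] [Finite E] [Algebra K E] [Finite K] [CharP K 2] (u : E) :
    Algebra.trace K E (u ^ 2) = Algebra.trace K E u ^ 2 := by
  have : CharP E 2 := charP_of_injective_algebraMap (algebraMap K E).injective 2
  apply (algebraMap K E).injective
  rw [map_pow (algebraMap K E), trace_eq_sum_automorphisms, trace_eq_sum_automorphisms,
    sum_pow_char 2]
  simp only [map_pow]

/-- A subspace that contains a hyperplane of the fixed field and on which the norm is
injective is the fixed field. -/
lemma eq_fixedField_of_three_le_finrank [Finite K] [CharP K 2] [FiniteDimensional K L]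
    {σ : L ≃ₐ[K] L}
    (hσ : ∀ x, σ (σ x) = x) {F : IntermediateField K L} (hF : ∀ x, x ∈ F ↔ σ x = x)
    (hF4 : Module.finrank K F = 4) {W : Submodule K L} (hW : Module.finrank K W = 4)
    (hinj : ∀ x ∈ W, ∀ y ∈ W, x * σ x = y * σ y → x = y)
    (h3 : 3 ≤ Module.finrank K (W ⊓ F.toSubmodule : Submodule K L)) :
    W = F.toSubmodule := by
  have hF4' : Module.finrank K F.toSubmodule = 4 := hF4
  by_contra hne
  have hnot : ¬ F.toSubmodule ≤ W := fun h =>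
    hne (Submodule.eq_of_le_of_finrank_eq h (hF4'.trans hW.symm)).symm
  have : FiniteDimensional K F := inferInstance
  have : Finite L := Module.finite_of_finite K
  have hsep := traceForm_nondegenerate K F
  let W₀ : Submodule K F := W.comap F.toSubmodule.subtype
  have hW₀ : 3 ≤ Module.finrank K W₀ := by
    refine h3.trans_eq ?_
    have e := LinearEquiv.finrank_eq (Submodule.equivMapOfInjective F.toSubmodule.subtype
      F.toSubmodule.injective_subtype W₀)
    refine Eq.trans ?_ e.symm
    rw [Submodule.map_comap_subtype, inf_comm]
  obtain ⟨v, hvF, hvW⟩ := Set.not_subset.1 hnot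
  have hv : (⟨v, hvF⟩ : F) ∉ W₀ := hvW
  obtain ⟨φ, hφv, hφW⟩ := Submodule.exists_le_ker_of_notMem hv
  have hφker : LinearMap.ker φ = W₀ := by
    symm
    refine Submodule.eq_of_le_of_finrank_le hφW ?_
    have h1 : LinearMap.ker φ ≠ ⊤ := fun h => hφv (by
      have : (⟨v, hvF⟩ : F) ∈ LinearMap.ker φ := h ▸ Submodule.mem_top
      exact this)
    have h2 := Submodule.finrank_lt h1
    rw [hF4] at h2
    omega
  obtain ⟨ω, rfl⟩ : ∃ ω : F, Algebra.traceForm K F ω = φ :=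
    ⟨_, LinearMap.ext (LinearMap.BilinForm.apply_toDual_symm_apply (hB := hsep) φ)⟩
  have hω : ∀ u : F, Algebra.trace K F (ω * u) = 0 ↔ (u : L) ∈ W := by
    intro u
    have : u ∈ LinearMap.ker (Algebra.traceForm K F ω) ↔ u ∈ W₀ := by rw [hφker]
    exact this
  have hω0 : ω ≠ 0 := by
    rintro rfl
    simp at hφv
  -- The weight ω² is chosen so that f(N(h)) = Tr((ωh)²) = Tr(ωh)² for h ∈ F, which vanishes when h
  -- also lies in W.
  obtain ⟨f, hf⟩ := LinearMap.exists_extend (p := F.toSubmodule) (Algebra.traceForm K F (ω ^ 2))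
  have hf' : ∀ u : F, f u = Algebra.trace K F (ω ^ 2 * u) := fun u =>
    DFunLike.congr_fun hf u
  obtain ⟨h, hhW, hrad, hne0⟩ := exists_mem_radical hσ hF (hW.trans hF4.symm) hinj f (by
    by_contra! H
    have := hsep.1 (ω ^ 2) fun u => (hf' u).symm.trans (H u u.2)
    exact pow_ne_zero 2 hω0 this)
  by_cases hhF : h ∈ F
  · have e1 : h * σ h = ((⟨h, hhF⟩ : F) ^ 2 : F) := by
      rw [(hF h).1 hhF]; simp [sq]
    rw [e1, hf', ← mul_pow, trace_sq, (hω ⟨h, hhF⟩).2 hhW] at hne0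
    simp at hne0
  -- For h outside F and u ∈ W ∩ F, T(h, u) = (h + σ h) u, so the radical condition compares two
  -- functionals on the hyperplane W ∩ F.
  have htF : h + σ h ∈ F := by rw [hF, map_add, hσ, add_comm]
  let t : F := ⟨h + σ h, htF⟩
  obtain ⟨c, hc⟩ : ∃ c : K, c • Algebra.traceForm K F ω = Algebra.traceForm K F (ω ^ 2 * t) := by
    have := mem_span_of_iInf_ker_le_ker (L := fun _ : Unit => Algebra.traceForm K F ω)
      (K := Algebra.traceForm K F (ω ^ 2 * t)) (by
        rw [iInf_const]
        intro u hu
        have hu' : (u : L) ∈ W := (hω u).1 hu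
        have h1 := hrad u hu'
        have e2 : traceProduct σ h u = ((t * u : F) : L) := by
          simp only [traceProduct_apply, (hF u).1 u.2, t, MulMemClass.coe_mul]
          ring
        rw [e2, hf', ← mul_assoc] at h1
        exact h1)
    simpa [Set.range_const, Submodule.mem_span_singleton] using this
  have hct : c • ω = ω ^ 2 * t := by
    have := hsep.1 (c • ω - ω ^ 2 * t) fun u => by
      rw [map_sub, map_smul, hc, sub_self, LinearMap.zero_apply]
    exact sub_eq_zero.1 this
  have hωt : ω * t = algebraMap K F c := by
    apply mul_left_cancel₀ hω0
    rw [← mul_assoc, ← sq, ← hct, Algebra.smul_def, mul_comm]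
  have htW : h + σ h ∈ W := by
    -- The trace of the scalar c is 4c = 0: the degree of F over K is even.
    rw [← hω t, hωt, Algebra.trace_algebraMap, hF4]
    rw [show (4 : ℕ) = 2 + 2 from rfl, add_smul, CharTwo.add_self_eq_zero]
  have hσW : σ h ∈ W := by
    have := W.sub_mem htW hhW
    rwa [add_sub_cancel_left] at this
  -- h and σ h both lie in W and have the same norm.
  exact hhF ((hF h).2 (hinj _ hσW _ hhW (by rw [hσ, mul_comm])))

/-! ### Proportionality over F and the Pfaffian relations. -/

variable [CharP L 2]

lemma traceProduct_self (σ : L ≃ₐ[K] L) (x : L) : traceProduct σ x x = 0 := by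
  rw [traceProduct_apply, mul_comm (σ x), CharTwo.add_self_eq_zero]

lemma traceProduct_eq_zero_iff {σ : L ≃ₐ[K] L} {x y : L} :
    traceProduct σ x y = 0 ↔ x * σ y = σ x * y := by
  rw [traceProduct_apply, CharTwo.add_eq_zero]

/-- Being proportional over F is an equivalence relation on nonzero vectors; for transitivity only
the middle vector has to be nonzero. -/
lemma traceProduct_trans {σ : L ≃ₐ[K] L} {x y z : L} (hy : y ≠ 0)
    (hxy : traceProduct σ x y = 0) (hyz : traceProduct σ y z = 0) :
    traceProduct σ x z = 0 := by
  rw [traceProduct_eq_zero_iff] at *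
  have hy' : σ y ≠ 0 := by simpa using hy
  apply mul_right_cancel₀ hy
  linear_combination x * hyz + z * hxy

/-- A functional vanishing on a subspace but at neither of two vectors outside it. -/
lemma exists_functional_ne_zero_ne_zero {V : Type*} [AddCommGroup V] [Module K V]
    {P : Submodule K V} {u v : V} (hu : u ∉ P) (hv : v ∉ P) :
    ∃ f : V →ₗ[K] K, (∀ p ∈ P, f p = 0) ∧ f u ≠ 0 ∧ f v ≠ 0 := by
  obtain ⟨f, hfu, hfP⟩ := Submodule.exists_le_ker_of_notMem hu
  obtain ⟨g, hgv, hgP⟩ := Submodule.exists_le_ker_of_notMem hv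
  have hfP' : ∀ p ∈ P, f p = 0 := fun p hp => hfP hp
  have hgP' : ∀ p ∈ P, g p = 0 := fun p hp => hgP hp
  by_cases h1 : f v = 0
  · by_cases h2 : g u = 0
    · exact ⟨f + g, fun p hp => by simp [hfP' p hp, hgP' p hp], by simpa [h2] using hfu,
        by simpa [h1] using hgv⟩
    · exact ⟨g, hgP', h2, hgv⟩
  · exact ⟨f, hfP', hfu, h1⟩

/-- The Pfaffian condition in coordinates. -/
lemma traceProduct_mem_span_pair [Finite K] [CharP K 2] [FiniteDimensional K L] {σ : L ≃ₐ[K] L}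
    (hσ : ∀ x, σ (σ x) = x) {F : IntermediateField K L} (hF : ∀ x, x ∈ F ↔ σ x = x)
    {W : Submodule K L} (hW : Module.finrank K W = Module.finrank K F)
    (hinj : ∀ x ∈ W, ∀ y ∈ W, x * σ x = y * σ y → x = y)
    {e₁ e₂ e₃ e₄ : L} (h₁ : e₁ ∈ W) (h₂ : e₂ ∈ W) (h₃ : e₃ ∈ W) (h₄ : e₄ ∈ W)
    (hspan : ∀ w ∈ W, ∃ a b c d : K, w = a • e₁ + b • e₂ + c • e₃ + d • e₄)
    (h₁₂ : traceProduct σ e₁ e₂ ∉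
      Submodule.span K {traceProduct σ e₁ e₃, traceProduct σ e₁ e₄}) :
    ∃ a b : K, traceProduct σ e₃ e₄ = a • traceProduct σ e₁ e₃ + b • traceProduct σ e₁ e₄ := by
  by_contra H
  have h₃₄ : traceProduct σ e₃ e₄ ∉
      Submodule.span K {traceProduct σ e₁ e₃, traceProduct σ e₁ e₄} := by
    rw [Submodule.mem_span_pair]
    rintro ⟨a, b, h⟩
    exact H ⟨a, b, h.symm⟩
  obtain ⟨f, hfP, hf₁₂, hf₃₄⟩ := exists_functional_ne_zero_ne_zero h₁₂ h₃₄
  have f13 : f (traceProduct σ e₁ e₃) = 0 := hfP _ (Submodule.subset_span (by simp))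
  have f14 : f (traceProduct σ e₁ e₄) = 0 := hfP _ (Submodule.subset_span (by simp))
  obtain ⟨h, hh, hrad, hne⟩ := exists_mem_radical hσ hF hW hinj f
    ⟨_, traceProduct_mem hσ hF e₁ e₂, hf₁₂⟩
  obtain ⟨a, b, c, d, rfl⟩ := hspan h hh
  -- The Pfaffian of f ∘ T reduces to f(T(e₁, e₂)) f(T(e₃, e₄)) ≠ 0, so the radical is zero: pairing
  -- with e₁, then e₃ and e₄, then e₂ kills all coordinates of h.
  have r1 := hrad e₁ h₁
  have r2 := hrad e₂ h₂
  have r3 := hrad e₃ h₃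
  have r4 := hrad e₄ h₄
  simp only [map_add, map_smul, LinearMap.add_apply, LinearMap.smul_apply, traceProduct_self,
    traceProduct_comm σ e₂ e₁, traceProduct_comm σ e₃ e₁, traceProduct_comm σ e₄ e₁,
    traceProduct_comm σ e₄ e₃, f13, f14, smul_eq_mul, mul_zero, smul_zero, add_zero,
    zero_add, mul_eq_zero, hf₁₂, or_false] at r1 r3 r4
  subst r1
  simp only [zero_mul, zero_add, mul_eq_zero, hf₃₄, or_false] at r3 r4
  subst r3 r4
  simp only [zero_smul, add_zero, map_smul, LinearMap.smul_apply, smul_eq_mul, mul_eq_zero,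
    hf₁₂, or_false] at r2
  subst r2
  simp at hne

/-- Two independent pairs of `σ`-proportional vectors are `σ`-proportional to each other. -/
lemma traceProduct_eq_zero_of_pairs [Finite K] [CharP K 2] [FiniteDimensional K L]
    {σ : L ≃ₐ[K] L}
    (hσ : ∀ x, σ (σ x) = x) {F : IntermediateField K L} (hF : ∀ x, x ∈ F ↔ σ x = x)
    (hF4 : Module.finrank K F = 4) {W : Submodule K L} (hW : Module.finrank K W = 4)
    (hinj : ∀ x ∈ W, ∀ y ∈ W, x * σ x = y * σ y → x = y)
    {e₁ e₂ e₃ e₄ : L} (h₁ : e₁ ∈ W) (h₂ : e₂ ∈ W) (h₃ : e₃ ∈ W) (h₄ : e₄ ∈ W)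
    (h₁₂ : LinearIndependent K ![e₁, e₂]) (h₃₄ : LinearIndependent K ![e₃, e₄])
    (t₁₂ : traceProduct σ e₁ e₂ = 0) (t₃₄ : traceProduct σ e₃ e₄ = 0) :
    traceProduct σ e₁ e₃ = 0 := by
  by_contra H
  rw [LinearIndependent.pair_iff] at h₁₂ h₃₄
  have n1 : e₁ ≠ 0 := by rintro rfl; simp at H
  have n3 : e₃ ≠ 0 := by rintro rfl; simp at H
  have n4 : e₄ ≠ 0 := by rintro rfl; simpa using h₃₄ 0 1
  have li : LinearIndependent K ![e₁, e₂, e₃, e₄] := by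
    rw [Fintype.linearIndependent_iff]
    intro g hg
    simp only [Fin.sum_univ_four, Matrix.cons_val] at hg
    have huv : g 0 • e₁ + g 1 • e₂ = g 2 • e₃ + g 3 • e₄ := by
      rw [← CharTwo.add_eq_zero, ← hg]; abel
    -- A nonzero common vector of the two planes would be proportional to both e₁ and e₃.
    have hu : g 0 • e₁ + g 1 • e₂ = 0 := by
      by_contra hu
      refine H (traceProduct_trans (y := g 0 • e₁ + g 1 • e₂) hu ?_ ?_)
      · simp only [map_add, map_smul, traceProduct_self, t₁₂]; simp
      · rw [huv, traceProduct_comm]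
        simp only [map_add, map_smul, traceProduct_self, t₃₄]; simp
    obtain ⟨ha, hb⟩ := h₁₂ _ _ hu
    obtain ⟨hc, hd⟩ := h₃₄ _ _ (huv.symm.trans hu)
    intro i
    fin_cases i <;> assumption
  have hsp : Submodule.span K (Set.range ![e₁, e₂, e₃, e₄]) = W := by
    refine Submodule.eq_of_le_of_finrank_eq (Submodule.span_le.2 ?_) ?_
    · rintro _ ⟨i, rfl⟩
      fin_cases i <;> assumption
    · rw [finrank_span_eq_card li, hW]; rfl
  have hspan : ∀ w ∈ W, ∃ a b c d : K, w = a • e₁ + b • e₃ + c • e₂ + d • e₄ := by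
    intro w hw
    rw [← hsp, Submodule.mem_span_range_iff_exists_fun] at hw
    obtain ⟨g, rfl⟩ := hw
    refine ⟨g 0, g 2, g 1, g 3, ?_⟩
    simp only [Fin.sum_univ_four, Matrix.cons_val]
    abel
  -- In the order e₁, e₃, e₂, e₄ the term T(e₁, e₂) is zero, so T(e₂, e₄) is a K-multiple of T(e₁,
  -- e₄). Hence some e₂ + b e₁, still proportional to e₁, is proportional to e₄.
  obtain ⟨a, b, hab⟩ := traceProduct_mem_span_pair hσ hF (hW.trans hF4.symm) hinj h₁ h₃ h₂ h₄
    hspan (by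
      rw [Submodule.mem_span_pair]
      rintro ⟨a, b, h⟩
      rw [t₁₂, smul_zero, zero_add] at h
      have h' : traceProduct σ e₁ (b • e₄ + e₃) = 0 := by
        rw [map_add, map_smul, h, CharTwo.add_self_eq_zero]
      have hne : b • e₄ + e₃ ≠ 0 := by
        intro h0
        simpa using h₃₄ 1 b (by rw [← h0]; simp [add_comm])
      refine H (traceProduct_trans hne h' ?_)
      simp [traceProduct_comm σ _ e₃, t₃₄, traceProduct_self, -traceProduct_apply])
  rw [t₁₂, smul_zero, zero_add] at hab
  have hne : e₂ + b • e₁ ≠ 0 := by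
    intro h0
    simpa using h₁₂ b 1 (by rw [← h0]; simp [add_comm])
  have h24 : traceProduct σ (e₂ + b • e₁) e₄ = 0 := by
    rw [map_add, map_smul, LinearMap.add_apply, LinearMap.smul_apply, hab,
      CharTwo.add_self_eq_zero]
  have h14 : traceProduct σ e₁ e₄ = 0 := by
    refine traceProduct_trans hne ?_ h24
    rw [map_add, map_smul, t₁₂, traceProduct_self, smul_zero, add_zero]
  exact H (traceProduct_trans n4 h14 (by rw [traceProduct_comm, t₃₄]))

/-- Independence of the T(e₁, eᵢ) supplies the non-membership needed for the Pfaffian relation.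
Being symmetric in e₂, e₃, e₄, it allows the relation to be used in several bases. -/
lemma mem_span_pair_of_independent [Finite K] [CharP K 2] [FiniteDimensional K L]
    {σ : L ≃ₐ[K] L}
    (hσ : ∀ x, σ (σ x) = x) {F : IntermediateField K L} (hF : ∀ x, x ∈ F ↔ σ x = x)
    {W : Submodule K L} (hW : Module.finrank K W = Module.finrank K F)
    (hinj : ∀ x ∈ W, ∀ y ∈ W, x * σ x = y * σ y → x = y)
    {e₁ e₂ e₃ e₄ : L} (h₁ : e₁ ∈ W) (h₂ : e₂ ∈ W) (h₃ : e₃ ∈ W) (h₄ : e₄ ∈ W)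
    (hspan : ∀ w ∈ W, ∃ a b c d : K, w = a • e₁ + b • e₂ + c • e₃ + d • e₄)
    (hind : ∀ b c d : K, traceProduct σ e₁ (b • e₂ + c • e₃ + d • e₄) = 0 →
      b = 0 ∧ c = 0 ∧ d = 0) :
    ∃ a b : K, traceProduct σ e₃ e₄ = a • traceProduct σ e₁ e₃ + b • traceProduct σ e₁ e₄ := by
  refine traceProduct_mem_span_pair hσ hF hW hinj h₁ h₂ h₃ h₄ hspan ?_
  rw [Submodule.mem_span_pair]
  rintro ⟨a, b, h⟩
  have := (hind 1 a b (by
    rw [map_add, map_add, map_smul, map_smul, map_smul, one_smul, add_assoc, h,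
      CharTwo.add_self_eq_zero])).1
  exact one_ne_zero this

/-- If `e₁` is `σ`-proportional to no other direction of `W`, then some other vector of `W`
is `σ`-proportional to a whole hyperplane of `W`. -/
lemma exists_three_le_finrank_of_basis [Finite K] [CharP K 2] [FiniteDimensional K L]
    {σ : L ≃ₐ[K] L}
    (hσ : ∀ x, σ (σ x) = x) {F : IntermediateField K L} (hF : ∀ x, x ∈ F ↔ σ x = x)
    {W : Submodule K L} (hW : Module.finrank K W = Module.finrank K F)
    (hinj : ∀ x ∈ W, ∀ y ∈ W, x * σ x = y * σ y → x = y)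
    {e₁ e₂ e₃ e₄ : L} (h₁ : e₁ ∈ W) (h₂ : e₂ ∈ W) (h₃ : e₃ ∈ W) (h₄ : e₄ ∈ W)
    (hspan : ∀ w ∈ W, ∃ a b c d : K, w = a • e₁ + b • e₂ + c • e₃ + d • e₄)
    (hind : ∀ b c d : K, traceProduct σ e₁ (b • e₂ + c • e₃ + d • e₄) = 0 →
      b = 0 ∧ c = 0 ∧ d = 0) :
    ∃ y ∈ W, y ≠ 0 ∧
      3 ≤ Module.finrank K (W ⊓ LinearMap.ker (traceProduct σ y) : Submodule K L) := by
  obtain ⟨a, b, h23⟩ := mem_span_pair_of_independent hσ hF hW hinj h₁ h₄ h₂ h₃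
    (fun w hw => by
      obtain ⟨a, b, c, d, rfl⟩ := hspan w hw
      exact ⟨a, d, b, c, by abel⟩)
    (fun b c d h => by
      obtain ⟨h1, h2, h3⟩ := hind c d b (by rw [← h]; congr 1; abel)
      exact ⟨h3, h1, h2⟩)
  obtain ⟨c, d, h24⟩ := mem_span_pair_of_independent hσ hF hW hinj h₁ h₃ h₂ h₄
    (fun w hw => by
      obtain ⟨a, b, c, d, rfl⟩ := hspan w hw
      exact ⟨a, c, b, d, by abel⟩)
    (fun b c d h => by
      obtain ⟨h1, h2, h3⟩ := hind c b d (by rw [← h]; congr 1; abel)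
      exact ⟨h2, h1, h3⟩)
  -- Replacing e₃ by e₃ + e₄ gives a third relation. Compared with the sum of the first two, it
  -- forces the coefficients of T(e₁, e₃) and T(e₁, e₄) to agree: b = r = d. The single vector e₂ +
  -- b e₁ then serves both e₃ and e₄.
  obtain ⟨p, r, h234⟩ := mem_span_pair_of_independent hσ hF hW hinj h₁ h₄ h₂ (add_mem h₃ h₄)
    (fun w hw => by
      obtain ⟨a, b, c, d, rfl⟩ := hspan w hw
      exact ⟨a, d - c, b, c, by module⟩)
    (fun b c d h => by
      obtain ⟨h1, h2, h3⟩ := hind c d (b + d) (by rw [← h]; congr 1; module)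
      subst h2
      exact ⟨by simpa using h3, h1, rfl⟩)
  have hsum := hind (a + c + p) (b + r) (d + r) (by
    rw [map_add, h23, h24, map_add] at h234
    simp only [map_add, map_smul, add_smul]
    rw [← sub_eq_zero, CharTwo.sub_eq_add] at h234
    rw [← h234]; module)
  obtain ⟨-, hb, hd⟩ := hsum
  rw [CharTwo.add_eq_zero] at hb hd
  obtain rfl : b = d := hb.trans hd.symm
  have t23 : traceProduct σ (e₂ + b • e₁) (e₃ + a • e₁) = 0 := by
    simp only [map_add, map_smul, LinearMap.add_apply, LinearMap.smul_apply, traceProduct_self,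
      h23, traceProduct_comm σ e₂ e₁, smul_zero, add_zero]
    rw [← CharTwo.add_self_eq_zero (a • traceProduct σ e₁ e₂ + b • traceProduct σ e₁ e₃)]
    abel
  have t24 : traceProduct σ (e₂ + b • e₁) (e₄ + c • e₁) = 0 := by
    simp only [map_add, map_smul, LinearMap.add_apply, LinearMap.smul_apply, traceProduct_self,
      h24, traceProduct_comm σ e₂ e₁, smul_zero, add_zero]
    rw [← CharTwo.add_self_eq_zero (c • traceProduct σ e₁ e₂ + b • traceProduct σ e₁ e₄)]
    abel
  have li : LinearIndependent K ![e₂ + b • e₁, e₃ + a • e₁, e₄ + c • e₁] := by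
    rw [Fintype.linearIndependent_iff]
    intro g hg
    simp only [Fin.sum_univ_three, Matrix.cons_val] at hg
    obtain ⟨h1, h2, h3⟩ := hind (g 0) (g 1) (g 2) (by
      have := congrArg (traceProduct σ e₁) hg
      simp only [map_add, map_smul, traceProduct_self, smul_zero, add_zero, map_zero] at this
      simp only [map_add, map_smul, this])
    intro i
    fin_cases i <;> assumption
  refine ⟨e₂ + b • e₁, add_mem h₂ (W.smul_mem _ h₁), li.ne_zero 0, ?_⟩
  have hle : Submodule.span K (Set.range ![e₂ + b • e₁, e₃ + a • e₁, e₄ + c • e₁]) ≤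
      W ⊓ LinearMap.ker (traceProduct σ (e₂ + b • e₁)) := by
    rw [Submodule.span_le]
    rintro _ ⟨i, rfl⟩
    fin_cases i
    · exact ⟨add_mem h₂ (W.smul_mem _ h₁), traceProduct_self σ _⟩
    · exact ⟨add_mem h₃ (W.smul_mem _ h₁), t23⟩
    · exact ⟨add_mem h₄ (W.smul_mem _ h₁), t24⟩
  have := Submodule.finrank_mono hle
  rwa [finrank_span_eq_card li, Fintype.card_fin] at this

/-- A nonzero vector of a four-dimensional space is part of a basis. -/
lemma exists_basis_extending {V : Type*} [AddCommGroup V] [Module K V] [FiniteDimensional K V]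
    (hV : Module.finrank K V = 4) {x : V} (hx : x ≠ 0) :
    ∃ e₂ e₃ e₄ : V, (∀ w, ∃ a b c d : K, w = a • x + b • e₂ + c • e₃ + d • e₄) ∧
      ∀ b c d : K, b • e₂ + c • e₃ + d • e₄ ∈ Submodule.span K {x} → b = 0 ∧ c = 0 ∧ d = 0 := by
  obtain ⟨C, hC⟩ := (Submodule.span K {x}).exists_isCompl
  have hC3 : Module.finrank K C = 3 := by
    have h1 := Submodule.finrank_add_eq_of_isCompl hC
    rw [finrank_span_singleton hx, hV] at h1
    omega
  let b := Module.finBasisOfFinrankEq K C hC3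
  refine ⟨b 0, b 1, b 2, fun w => ?_, fun c₀ c₁ c₂ h => ?_⟩
  · have hmem : w ∈ Submodule.span K {x} ⊔ C := by
      rw [hC.sup_eq_top]; trivial
    obtain ⟨u, hu, v, hv, huv⟩ := Submodule.mem_sup.1 hmem
    obtain ⟨a, rfl⟩ := Submodule.mem_span_singleton.1 hu
    have hv' := congrArg (fun z : C => (z : V)) (b.sum_repr ⟨v, hv⟩)
    refine ⟨a, b.repr ⟨v, hv⟩ 0, b.repr ⟨v, hv⟩ 1, b.repr ⟨v, hv⟩ 2, ?_⟩
    simp only [Fin.sum_univ_three, Submodule.coe_add, Submodule.coe_smul] at hv'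
    rw [← huv, add_assoc, add_assoc, ← add_assoc (_ • (b 0 : V)), hv']
  · have hz : c₀ • b 0 + c₁ • b 1 + c₂ • b 2 = 0 :=
      Subtype.ext (Submodule.disjoint_def.1 hC.disjoint _ h (c₀ • b 0 + c₁ • b 1 + c₂ • b 2).2)
    have hl := Fintype.linearIndependent_iff.1 b.linearIndependent ![c₀, c₁, c₂]
      (by rw [Fin.sum_univ_three]; exact hz)
    exact ⟨hl 0, hl 1, hl 2⟩

lemma exists_three_le_finrank [Finite K] [CharP K 2] [FiniteDimensional K L]
    {σ : L ≃ₐ[K] L}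
    (hσ : ∀ x, σ (σ x) = x) {F : IntermediateField K L} (hF : ∀ x, x ∈ F ↔ σ x = x)
    (hF4 : Module.finrank K F = 4) {W : Submodule K L} (hW : Module.finrank K W = 4)
    (hinj : ∀ x ∈ W, ∀ y ∈ W, x * σ x = y * σ y → x = y)
    {x : L} (hx : x ∈ W) (hx0 : x ≠ 0)
    (hker : ∀ w ∈ W, traceProduct σ x w = 0 → w ∈ Submodule.span K {x}) :
    ∃ y ∈ W, y ≠ 0 ∧
      3 ≤ Module.finrank K (W ⊓ LinearMap.ker (traceProduct σ y) : Submodule K L) := by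
  obtain ⟨e₂, e₃, e₄, hspan, hind⟩ := exists_basis_extending hW (x := (⟨x, hx⟩ : W))
    (by simpa using hx0)
  refine exists_three_le_finrank_of_basis hσ hF (hW.trans hF4.symm) hinj hx
    e₂.2 e₃.2 e₄.2 (fun w hw => ?_) fun b c d h => ?_
  · obtain ⟨a, b, c, d, h⟩ := hspan ⟨w, hw⟩
    exact ⟨a, b, c, d, congrArg Subtype.val h⟩
  · obtain ⟨a, ha⟩ := Submodule.mem_span_singleton.1
      (hker _ (b • e₂ + c • e₃ + d • e₄).2 h)
    exact hind b c d (Submodule.mem_span_singleton.2 ⟨a, Subtype.ext ha⟩)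

/-- Any two vectors of `W` are `σ`-proportional. -/
theorem traceProduct_eq_zero_of_injOn [Finite K] [CharP K 2] [FiniteDimensional K L]
    {σ : L ≃ₐ[K] L}
    (hσ : ∀ x, σ (σ x) = x) {F : IntermediateField K L} (hF : ∀ x, x ∈ F ↔ σ x = x)
    (hF4 : Module.finrank K F = 4) {W : Submodule K L} (hW : Module.finrank K W = 4)
    (hinj : ∀ x ∈ W, ∀ y ∈ W, x * σ x = y * σ y → x = y)
    {x y : L} (hx : x ∈ W) (hy : y ∈ W) : traceProduct σ x y = 0 := by
  -- Either every nonzero vector of W has an independent proportional partner in W, or some vector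
  -- is isolated.
  by_cases H : ∀ x ∈ W, x ≠ 0 → ∃ w ∈ W, traceProduct σ x w = 0 ∧ w ∉ Submodule.span K {x}
  · by_cases hx0 : x = 0
    · simp [hx0]
    by_cases hy0 : y = 0
    · simp [hy0]
    obtain ⟨x', hx', tx, nx⟩ := H x hx hx0
    obtain ⟨y', hy', ty, ny⟩ := H y hy hy0
    rw [Submodule.mem_span_singleton, not_exists] at nx ny
    exact traceProduct_eq_zero_of_pairs hσ hF hF4 hW hinj hx hx' hy hy'
      ((LinearIndependent.pair_iff' hx0).2 nx) ((LinearIndependent.pair_iff' hy0).2 ny) tx ty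
  · push Not at H
    obtain ⟨z, hz, hz0, hker⟩ := H
    obtain ⟨e, he, he0, h3⟩ := exists_three_le_finrank hσ hF hF4 hW hinj hz hz0 hker
    have hσe : σ e ≠ 0 := by simpa using he0
    -- Scaling by e⁻¹ turns the line eF into F and multiplies all norms by a constant, so
    -- injectivity of the norm survives.
    let m : L →ₗ[K] L := LinearMap.mulLeft K e⁻¹
    have hm : Function.Injective m := fun a b hab => mul_left_cancel₀ (inv_ne_zero he0) hab
    have hfin : ∀ U : Submodule K L, Module.finrank K (U.map m) = Module.finrank K U := fun U =>
      (LinearEquiv.finrank_eq (Submodule.equivMapOfInjective m hm U)).symm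
    have hmF : ∀ w, traceProduct σ e w = 0 ↔ m w ∈ F := by
      intro w
      rw [hF, traceProduct_eq_zero_iff]
      simp only [m, LinearMap.mulLeft_apply, map_mul, map_inv₀]
      constructor <;> intro h
      · field_simp; linear_combination h
      · field_simp at h; linear_combination h
    have hWF := eq_fixedField_of_three_le_finrank hσ hF hF4 (W := W.map m) ((hfin W).trans hW)
      (by
        rintro _ ⟨a, ha, rfl⟩ _ ⟨b, hb, rfl⟩ hab
        simp only [m, LinearMap.mulLeft_apply, map_mul] at hab ⊢
        rw [hinj a ha b hb]
        apply mul_left_cancel₀ (mul_ne_zero (inv_ne_zero he0)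
          (show σ e⁻¹ ≠ 0 by simpa using he0))
        linear_combination hab)
      (by
        refine h3.trans ((hfin _).symm.le.trans (Submodule.finrank_mono ?_))
        rintro _ ⟨w, ⟨hw, hw'⟩, rfl⟩
        exact ⟨⟨w, hw, rfl⟩, (hmF w).1 hw'⟩)
    have hall : ∀ w ∈ W, traceProduct σ e w = 0 := fun w hw => by
      rw [hmF]
      have : m w ∈ W.map m := ⟨w, hw, rfl⟩
      rwa [hWF] at this
    exact traceProduct_trans he0 (by rw [traceProduct_comm]; exact hall x hx) (hall y hy)

/-- The kernel is the F-line yF. -/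
lemma finrank_ker_traceProduct {σ : L ≃ₐ[K] L} {F : IntermediateField K L}
    (hF : ∀ x, x ∈ F ↔ σ x = x) {y : L} (hy : y ≠ 0) :
    Module.finrank K (LinearMap.ker (traceProduct σ y)) = Module.finrank K F := by
  have hm : Function.Injective (LinearMap.mulLeft K y) := fun a b hab => mul_left_cancel₀ hy hab
  have hσy : σ y ≠ 0 := by simpa using hy
  have e : F.toSubmodule.map (LinearMap.mulLeft K y) = LinearMap.ker (traceProduct σ y) := by
    ext w
    rw [LinearMap.mem_ker, traceProduct_eq_zero_iff]
    constructor
    · rintro ⟨u, hu, rfl⟩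
      have hu' : σ u = u := (hF u).1 hu
      simp only [LinearMap.mulLeft_apply, map_mul, hu']
      ring
    · intro h
      refine ⟨y⁻¹ * w, (hF _).2 ?_, by simp [hy]⟩
      rw [map_mul, map_inv₀]
      field_simp
      linear_combination h
  rw [← e]
  exact (LinearEquiv.finrank_eq (Submodule.equivMapOfInjective _ hm F.toSubmodule)).symm

end Involution

/-! ### Spreads, norm-one invariance and the Singer group. -/

section Spreads

lemma IsSpread.of_isomorphic {K V : Type*} [Field K] [Finite K] [AddCommGroup V] [Module K V]
    [Finite V] {n : ℕ} {S T : Set (Submodule K V)} (hS : IsSpread n S)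
    (h : SpreadIsomorphic S T) : IsSpread n T := by
  obtain ⟨g, ⟨hadd, -⟩, hST⟩ := h
  obtain ⟨hV, hdim, huniq⟩ := hS
  have hg0 : g 0 = 0 := by simpa using hadd 0 0
  have hT : ∀ W' ∈ T, ∃ W ∈ S, g '' (W : Set V) = W' := fun W' hW' => by
    have : (W' : Set V) ∈ (fun W : Submodule K V => (W : Set V)) '' T := ⟨W', hW', rfl⟩
    rwa [← hST] at this
  refine ⟨hV, fun W' hW' => ?_, fun v hv => ?_⟩
  · obtain ⟨W, hW, e⟩ := hT W' hW'
    -- As g is only semilinear, dimensions are compared by counting elements.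
    have h1 : Nat.card W' = Nat.card W := by
      have := Nat.card_image_of_injective g.injective (W : Set V)
      rw [e] at this
      exact this
    rw [Module.natCard_eq_pow_finrank (K := K), Module.natCard_eq_pow_finrank (K := K) (V := W),
      hdim W hW] at h1
    exact Nat.pow_right_injective Finite.one_lt_card h1
  · have hw : g.symm v ≠ 0 := fun h0 => hv (by rw [← hg0, ← h0, g.apply_symm_apply])
    obtain ⟨W, ⟨hW, hvW⟩, huW⟩ := huniq _ hw
    have hmem : g '' (W : Set V) ∈ (fun W : Submodule K V => (W : Set V)) '' T := by
      rw [← hST]; exact ⟨W, hW, rfl⟩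
    obtain ⟨W', hW', e⟩ := hmem
    refine ⟨W', ⟨hW', ?_⟩, fun U' hU' => ?_⟩
    · have : v ∈ (W' : Set V) := by
        rw [show (W' : Set V) = g '' W from e]
        exact ⟨_, hvW, g.apply_symm_apply v⟩
      exact this
    · obtain ⟨U, hU, eU⟩ := hT U' hU'.1
      have hvU : v ∈ g '' (U : Set V) := by rw [eU]; exact hU'.2
      obtain ⟨u, hu, rfl⟩ := hvU
      rw [g.symm_apply_apply] at huW hvW
      obtain rfl := huW U ⟨hU, hu⟩
      exact SetLike.coe_injective (eU.symm.trans e.symm)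

variable {K L : Type*} [Field K] [Field L] [Algebra K L]

/-- A unit that permutes the nonzero vectors of a finite subspace has order dividing their
number. -/
lemma pow_card_sub_one_eq_one_of_smul_mem [Finite L] (W : Submodule K L) {c : L} (hc : c ≠ 0)
    (h : ∀ w ∈ W, c * w ∈ W) : c ^ (Nat.card W - 1) = 1 := by
  classical
  let s : Finset L := (Set.toFinite (W : Set L)).toFinset.erase 0
  have hs : ∀ w, w ∈ s ↔ w ≠ 0 ∧ w ∈ W := fun w => by simp [s]
  have hcard : s.card = Nat.card W - 1 := by
    rw [Finset.card_erase_of_mem (by simp), ← Set.ncard_eq_toFinset_card]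
    rfl
  have himage : s.image (c * ·) = s := by
    refine Finset.eq_of_subset_of_card_le ?_ ?_
    · intro x hx
      obtain ⟨w, hw, rfl⟩ := Finset.mem_image.1 hx
      rw [hs] at hw ⊢
      exact ⟨mul_ne_zero hc hw.1, h w hw.2⟩
    · rw [Finset.card_image_of_injective _ (mul_right_injective₀ hc)]
  have hprod : ∏ w ∈ s, w = c ^ s.card * ∏ w ∈ s, w := by
    conv_lhs => rw [← himage]
    rw [Finset.prod_image (fun a _ b _ hab => mul_right_injective₀ hc hab),
      Finset.prod_mul_distrib, Finset.prod_const]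
  have hne : ∏ w ∈ s, w ≠ 0 := Finset.prod_ne_zero_iff.2 fun w hw => ((hs w).1 hw).1
  rw [← hcard]
  exact mul_right_cancel₀ hne (by rw [one_mul]; exact hprod.symm)

/-- If the spread is invariant under all elements of order dividing `q ^ n + 1`, then
`x ^ (q ^ n + 1)` is injective on its components. -/
lemma eq_of_pow_eq_pow [Finite K] [Finite L] [CharP L 2] {n : ℕ} {S : Set (Submodule K L)}
    (hS : IsSpread n S)
    (hinv : ∀ c : Lˣ, c ^ (Nat.card K ^ n + 1) = 1 → MulAction.toPermHom Lˣ L c ∈ spreadAut S)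
    {W : Submodule K L} (hW : W ∈ S) {x y : L} (hx : x ∈ W) (hy : y ∈ W)
    (hxy : x ^ (Nat.card K ^ n + 1) = y ^ (Nat.card K ^ n + 1)) : x = y := by
  by_cases hy0 : y = 0
  · subst hy0
    rw [zero_pow (Nat.succ_ne_zero _)] at hxy
    exact eq_zero_of_pow_eq_zero hxy
  by_cases hx0 : x = 0
  · subst hx0
    rw [zero_pow (Nat.succ_ne_zero _)] at hxy
    exact (eq_zero_of_pow_eq_zero hxy.symm).symm
  let c : Lˣ := Units.mk0 (x / y) (div_ne_zero hx0 hy0)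
  have hc1 : c ^ (Nat.card K ^ n + 1) = 1 := by
    ext
    simp only [c, Units.val_pow_eq_pow_val, Units.val_mk0, Units.val_one, div_pow]
    rw [hxy, div_self (pow_ne_zero _ hy0)]
  obtain ⟨-, hmaps⟩ := hinv c hc1
  have hmem : (MulAction.toPermHom Lˣ L c) '' (W : Set L) ∈
      (fun W : Submodule K L => (W : Set L)) '' S := by
    rw [← hmaps]; exact ⟨W, hW, rfl⟩
  obtain ⟨W', hW', e⟩ := hmem
  have hW'mem : ∀ w ∈ W, (c : L) * w ∈ W' := fun w hw => by
    have : (c : L) * w ∈ (W' : Set L) := by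
      rw [show (W' : Set L) = _ from e]
      exact ⟨w, hw, rfl⟩
    exact this
  have hcy : (c : L) * y = x := div_mul_cancel₀ x hy0
  -- Both cW and W are components containing x = cy ≠ 0, hence they coincide and c permutes the
  -- nonzero vectors of W.
  obtain rfl : W' = W := (hS.2.2 x hx0).unique ⟨hW', hcy ▸ hW'mem y hy⟩ ⟨hW, hx⟩
  have hc2 := pow_card_sub_one_eq_one_of_smul_mem W' c.ne_zero hW'mem
  rw [Module.natCard_eq_pow_finrank (K := K), hS.2.1 W' hW] at hc2
  have hpos : 0 < Nat.card K ^ n := pow_pos Nat.card_pos n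
  -- The order of c divides both q ^ n - 1 and q ^ n + 1, hence 2; in characteristic 2 this leaves c
  -- = 1.
  have hc3 : (c : L) ^ 2 = 1 := by
    have h1 : (c : L) ^ (Nat.card K ^ n + 1) = 1 := by
      rw [← Units.val_pow_eq_pow_val, hc1, Units.val_one]
    rwa [show Nat.card K ^ n + 1 = (Nat.card K ^ n - 1) + 2 by omega, pow_add, hc2, one_mul] at h1
  have hc4 : (c : L) = 1 := by
    have : ((c : L) - 1) ^ 2 = 0 := by
      rw [sub_pow_char, hc3, one_pow, sub_self]
    exact sub_eq_zero.1 (pow_eq_zero_iff two_ne_zero |>.1 this)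
  rw [← hcy, hc4, one_mul]

/-- A spread all of whose components are one-dimensional over the fixed field of `σ` is invariant
under the whole Singer group. -/
lemma singerGroup_le_spreadAut {σ : L ≃ₐ[K] L} {S : Set (Submodule K L)}
    (hker : ∀ W ∈ S, ∃ y ≠ 0, W = LinearMap.ker (traceProduct σ y))
    (hmem : ∀ y : L, y ≠ 0 → LinearMap.ker (traceProduct σ y) ∈ S) :
    singerGroup L ≤ spreadAut S := by
  -- Since T(ax, ay) = N(a) T(x, y), multiplication by a carries the line of y to the line of ay.
  have himage : ∀ (a : Lˣ) (y : L), MulAction.toPermHom Lˣ L a ''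
      (LinearMap.ker (traceProduct σ y) : Set L) = LinearMap.ker (traceProduct σ (a * y)) := by
    intro a y
    have hσa : σ a ≠ 0 := by simp
    ext w
    constructor
    · rintro ⟨v, hv, rfl⟩
      change traceProduct σ (a * y) (a * v) = 0
      rw [traceProduct_mul_mul, show traceProduct σ y v = 0 from hv, mul_zero]
    · intro hw
      refine ⟨(a⁻¹ : Lˣ) * w, ?_, ?_⟩
      · have h : traceProduct σ (a * y) (a * ((a⁻¹ : Lˣ) * w)) = 0 := by
          rw [Units.mul_inv_cancel_left]; exact hw
        rw [traceProduct_mul_mul] at h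
        exact (mul_eq_zero.1 h).resolve_left (mul_ne_zero a.ne_zero hσa)
      · exact Units.mul_inv_cancel_left a w
  rintro _ ⟨a, rfl⟩
  refine ⟨⟨fun u v => smul_add a u v, RingEquiv.refl K, fun c v => smul_comm a c v⟩, ?_⟩
  unfold MapsOnto
  ext X
  constructor
  · rintro ⟨W, hW, rfl⟩
    obtain ⟨y, hy, rfl⟩ := hker W hW
    exact ⟨_, hmem _ (mul_ne_zero a.ne_zero hy), (himage a y).symm⟩
  · rintro ⟨W, hW, rfl⟩
    obtain ⟨y, hy, rfl⟩ := hker W hW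
    refine ⟨_, hmem _ (mul_ne_zero (a⁻¹).ne_zero hy), ?_⟩
    simp only [himage, Units.mul_inv_cancel_left]

/-- An extension of degree `2n` of a finite field has an involution with fixed field of degree
`n`. -/
lemma exists_involution [Finite K] [FiniteDimensional K L] {n : ℕ} (hn : 0 < n)
    (hL : Module.finrank K L = 2 * n) :
    ∃ (σ : L ≃ₐ[K] L) (F : IntermediateField K L), (∀ x, σ x = x ^ Nat.card K ^ n) ∧
      (∀ x, σ (σ x) = x) ∧ (∀ x, x ∈ F ↔ σ x = x) ∧ Module.finrank K F = n := by
  have := Fintype.ofFinite K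
  have : Finite L := Module.finite_of_finite K
  let φ := FiniteField.frobeniusAlgEquivOfAlgebraic K L
  have hφ : orderOf φ = 2 * n := (FiniteField.orderOf_frobeniusAlgEquivOfAlgebraic K L).trans hL
  have hord : orderOf (φ ^ n) = 2 := by
    rw [orderOf_pow_of_dvd hn.ne' (by rw [hφ]; exact dvd_mul_left n 2), hφ,
      Nat.mul_div_cancel _ hn]
  refine ⟨φ ^ n, IntermediateField.fixedField (Subgroup.zpowers (φ ^ n)), fun x => ?_, fun x => ?_,
    fun x => ?_, ?_⟩
  · rw [AlgEquiv.coe_pow, FiniteField.coe_frobeniusAlgEquivOfAlgebraic_iterate,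
      Nat.card_eq_fintype_card]
  · rw [← AlgEquiv.mul_apply, ← sq, ← hord, pow_orderOf_eq_one, AlgEquiv.one_apply]
  · rw [IntermediateField.mem_fixedField_iff]
    constructor
    · exact fun h => h _ (Subgroup.mem_zpowers _)
    · intro h f hf
      have : Subgroup.zpowers (φ ^ n) ≤ MulAction.stabilizer (L ≃ₐ[K] L) x := by
        rw [Subgroup.zpowers_le]; exact h
      exact this hf
  · have h1 := Module.finrank_mul_finrank K
      (IntermediateField.fixedField (Subgroup.zpowers (φ ^ n))) L
    rw [IntermediateField.finrank_fixedField_eq_card, Nat.card_zpowers, hord, hL] at h1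
    omega

end Spreads

/-! ### Conclusion: the components are F-lines, and the order of β is too small. -/

theorem mainTheorem4 {K L : Type*} [Field K] [Finite K] [Field L] [Algebra K L]
    (hq : Even (Nat.card K)) (hL : Module.finrank K L = 8) :
    ¬ ∃ S : Set (Submodule K L), IsTypeC 4 S ∧ HasKernelBaseField S := by
  rintro ⟨S, ⟨hS, -, S', hiso, β, hβ, hAut⟩, -⟩
  have : FiniteDimensional K L := Module.finite_of_finrank_pos (by omega)
  have : Finite L := Module.finite_of_finite K
  have := Fintype.ofFinite K
  have : CharP K 2 := ringChar.of_eq (FiniteField.even_card_iff_char_two.2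
    (Nat.even_iff.1 (by rwa [← Nat.card_eq_fintype_card])))
  have : CharP L 2 := charP_of_injective_algebraMap (algebraMap K L).injective 2
  have hS' : IsSpread 4 S' := hS.of_isomorphic hiso
  obtain ⟨σ, F, hσpow, hσ, hF, hF4⟩ := exists_involution (K := K) (L := L) (n := 4) (by omega) hL
  have hq1 : 1 < Nat.card K := Finite.one_lt_card
  have hinv : ∀ c : Lˣ, c ^ (Nat.card K ^ 4 + 1) = 1 →
      MulAction.toPermHom Lˣ L c ∈ spreadAut S' := by
    intro c hc
    have hprim : IsPrimitiveRoot β ((Nat.card K ^ 4 + 1) * (Nat.card K - 1)) :=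
      hβ ▸ IsPrimitiveRoot.orderOf β
    have : NeZero ((Nat.card K ^ 4 + 1) * (Nat.card K - 1)) :=
      ⟨mul_ne_zero (Nat.succ_ne_zero _) (by omega)⟩
    have hmem : c ∈ Subgroup.zpowers β := by
      -- ⟨β⟩ consists of all roots of unity of its order, and q ^ 4 + 1 divides that order.
      rw [hprim.zpowers_eq, mem_rootsOfUnity, pow_mul, hc, one_pow]
    obtain ⟨k, rfl⟩ := hmem
    have : MulAction.toPermHom Lˣ L (β ^ k) ∈ spreadAut S' ⊓ singerGroup L := by
      rw [hAut]; exact ⟨k, (map_zpow _ _ _).symm⟩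
    exact this.1
  have hker : ∀ W ∈ S', ∀ y ∈ W, y ≠ 0 → W = LinearMap.ker (traceProduct σ y) := by
    intro W hW y hy hy0
    refine Submodule.eq_of_le_of_finrank_eq (fun w hw => ?_)
      ((hS'.2.1 W hW).trans (hF4.symm.trans (finrank_ker_traceProduct hF hy0).symm))
    refine traceProduct_eq_zero_of_injOn hσ hF hF4 (hS'.2.1 W hW) (fun u hu v hv huv => ?_) hy hw
    rw [hσpow, hσpow, ← pow_succ', ← pow_succ'] at huv
    exact eq_of_pow_eq_pow hS' hinv hW hu hv huv
  have hsinger : singerGroup L ≤ spreadAut S' := by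
    refine singerGroup_le_spreadAut (σ := σ) (fun W hW => ?_) fun y hy => ?_
    · have hbot : W ≠ ⊥ := by
        rintro rfl
        simpa using hS'.2.1 _ hW
      obtain ⟨y, hy, hy0⟩ := W.exists_mem_ne_zero_of_ne_bot hbot
      exact ⟨y, hy0, hker W hW y hy hy0⟩
    · obtain ⟨W, ⟨hW, hyW⟩, -⟩ := hS'.2.2 y hy
      rw [← hker W hW y hyW hy]
      exact hW
  rw [inf_eq_right.2 hsinger] at hAut
  have htop : ∀ c : Lˣ, c ∈ Subgroup.zpowers β := by
    intro c
    have hc : MulAction.toPermHom Lˣ L c ∈ singerGroup L := ⟨c, rfl⟩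
    rw [hAut] at hc
    obtain ⟨k, hk⟩ := hc
    exact ⟨k, MulAction.toPerm_injective ((map_zpow (MulAction.toPermHom Lˣ L) β k).trans hk)⟩
  have hord := orderOf_eq_card_of_forall_mem_zpowers htop
  rw [hβ, Nat.card_units, Module.natCard_eq_pow_finrank (K := K) (V := L), hL] at hord
  generalize Nat.card K = q at hord hq1
  have h8 : q ^ 8 - 1 = (q ^ 4 + 1) * (q ^ 4 - 1) := by
    rw [← Nat.sq_sub_sq (q ^ 4) 1 |>.trans rfl]; ring_nf
  rw [h8] at hord
  -- Cancelling q ^ 4 + 1 leaves q - 1 = q ^ 4 - 1, impossible for q > 1.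
  have h4 := Nat.eq_of_mul_eq_mul_left (Nat.succ_pos _) hord
  have := Nat.pow_lt_pow_right hq1 (show 1 < 4 by omega)
  rw [pow_one] at this
  omega
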